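/- For a positive integer $n$ write $[n]=\{1,\dots,n\}$, and let $\operatorname{Park}(n)$ be the set of parking functions of order $n$, i.e. of the functions $f:[n]\to[n]$ such that, if $A_1\le A_2\le\cdots\le A_n$ is the weakly increasing rearrangement of $f(1),\dots,f(n)$, then $A_i\le i$ for all $i\in[n]$. For $i\in[n]$ let $w_i:\operatorname{Park}(n)\to\operatorname{Park}(n)$ be whirling at index $i$: given $f\in\operatorname{Park}(n)$, add $1$ modulo $n$ (with representatives in $[n]$) to the value $f(i)$ repeatedly, at least once, until a function in $\operatorname{Park}(n)$ is obtained; this function is $w_i(f)$. Each $w_i$ is a bijection. Let $\mathbf{w}=w_n\circ\cdots\circ w_2\circ w_1$ and, for a permutation $\pi$ of $[n]$, let $\mathbf{w}_\pi=w_{\pi(n)}\circ\cdots\circ w_{\pi(2)}\circ w_{\pi(1)}$. **Theorem.** Let $n\ge 2$. 1. Every orbit of $\mathbf{w}$ on $\operatorname{Park}(n)$ has size $n+1$, and for every $i\in[n]$ every such orbit contains exactly two functions $f$ with $f(i)=1$. 2. More generally, for every permutation $\pi$ of $[n]$, every orbit of $\mathbf{w}_\pi$ on $\operatorname{Park}(n)$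 has size $n+1$, and for every $i\in[n]$ every such orbit contains exactly two functions $f$ with $f(i)=1$. -/

import Mathlib

/-!
Conventions: the set `[n] = {1, …, n}` is represented by `Fin n`, the element `j : Fin n` standing
for the integer `j + 1`. Thus the integer `1 ∈ [n]` is the `j : Fin n` with `(j : ℕ) = 0`, and
"add `1` modulo `k`" on `[k]` is the cyclic permutation `finRotate k` of `Fin k`.
-/

namespace Whirling

/-- The `i`-th entry of the weakly increasing rearrangement `f ∘ Tuple.sort f` of `f` is at most
`i`, for every `i`. (Both sides are shifted by one, so the inequality is the usual one.) -/
def IsParking {n : ℕ} (f : Fin n → Fin n) : Prop :=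
  ∀ i : Fin n, (f ∘ Tuple.sort f) i ≤ i

/-- The set of parking functions `[n] → [n]`. -/
def Park (n : ℕ) : Set (Fin n → Fin n) := {f | IsParking f}

/-- The function obtained from `f` by adding `1` (mod `k`) to the value `f i`, `m` times. -/
def bump {n k : ℕ} (f : Fin n → Fin k) (i : Fin n) (m : ℕ) : Fin n → Fin k :=
  Function.update f i ((finRotate k)^[m] (f i))

theorem exists_bump_mem {n k : ℕ} {F : Set (Fin n → Fin k)} (i : Fin n) (f : F) :
    ∃ m : ℕ, 0 < m ∧ bump f.1 i m ∈ F := by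
  refine ⟨orderOf (finRotate k), orderOf_pos _, ?_⟩
  have h : (finRotate k)^[orderOf (finRotate k)] (f.1 i) = f.1 i := by
    rw [Equiv.Perm.iterate_eq_pow, pow_orderOf_eq_one, Equiv.Perm.one_apply]
  rw [bump, h, Function.update_eq_self]
  exact f.2

open Classical in
/-- Whirling at index `i`, as a map `F → F`: add `1` (mod `k`) to the value at `i` repeatedly, at
least once, until the first time the function is in `F`. -/
noncomputable def whirlFun {n k : ℕ} (F : Set (Fin n → Fin k)) (i : Fin n) (f : F) : F :=
  ⟨bump f.1 i (Nat.find (exists_bump_mem i f)), (Nat.find_spec (exists_bump_mem i f)).2⟩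

theorem whirlFun_injective {n k : ℕ} (F : Set (Fin n → Fin k)) (i : Fin n) :
    Function.Injective (whirlFun F i) := by
  classical
  have key : ∀ (f g : F) (a b : ℕ), a ≤ b → (∀ m < b, ¬ (0 < m ∧ bump g.1 i m ∈ F)) → 0 < a →
      bump f.1 i a = bump g.1 i b → f = g := by
    intro f g a b hab hb ha h
    have hoff : ∀ j, j ≠ i → f.1 j = g.1 j := by
      intro j hj
      have := congrFun h j
      simpa [bump, hj] using this
    have hi : f.1 i = (finRotate k)^[b - a] (g.1 i) := by
      have h1 := congrFun h i
      simp only [bump, Function.update_self] at h1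
      have h2 : b = a + (b - a) := by omega
      rw [h2, Function.iterate_add_apply] at h1
      exact ((finRotate k).injective.iterate a) h1
    have hfg : f.1 = bump g.1 i (b - a) := by
      funext j
      by_cases hj : j = i
      · subst hj
        simp [bump, hi]
      · simp [bump, hj, hoff j hj]
    rcases Nat.eq_or_lt_of_le hab with e | l
    · apply Subtype.ext
      rw [hfg, e]
      simp [bump]
    · exact absurd ⟨by omega, hfg ▸ f.2⟩ (hb (b - a) (by omega))
  intro f g h
  have h' := congrArg Subtype.val h
  simp only [whirlFun] at h'
  rcases le_total (Nat.find (exists_bump_mem i f)) (Nat.find (exists_bump_mem i g)) with hl | hl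
  · exact key f g _ _ hl (fun m hm => Nat.find_min _ hm) (Nat.find_spec (exists_bump_mem i f)).1 h'
  · exact (key g f _ _ hl (fun m hm => Nat.find_min _ hm)
      (Nat.find_spec (exists_bump_mem i g)).1 h'.symm).symm

/-- Whirling at index `i`, the map `whirlFun F i`, as a permutation of the family `F`. -/
noncomputable def whirlAt {n k : ℕ} (F : Set (Fin n → Fin k)) (i : Fin n) : Equiv.Perm F :=
  Equiv.ofBijective (whirlFun F i) (Finite.injective_iff_bijective.mp (whirlFun_injective F i))

/-- Whirling in the order `π`: `w_{π(n)} ∘ ⋯ ∘ w_{π(2)} ∘ w_{π(1)}`. Products of permutations are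
composed from right to left, whence the reversal of the list. -/
noncomputable def whirlPerm {n k : ℕ} (F : Set (Fin n → Fin k)) (π : Equiv.Perm (Fin n)) :
    Equiv.Perm F :=
  ((List.finRange n).map fun j => whirlAt F (π j)).reverse.prod

/-- Left-to-right whirling: `w_n ∘ ⋯ ∘ w_2 ∘ w_1`. -/
noncomputable def whirl {n k : ℕ} (F : Set (Fin n → Fin k)) : Equiv.Perm F :=
  ((List.finRange n).map fun j => whirlAt F j).reverse.prod

/-- The set of orbits of a permutation `σ`, i.e. of the action of the cyclic group it generates. -/
def orbits {X : Type*} (σ : Equiv.Perm X) : Set (Set X) :=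
  Set.range fun x : X => MulAction.orbit (Subgroup.zpowers σ) x

end Whirling

/-!
Parking functions of order `n` are exactly the lists of smaller elements of the factorizations of
the inverse of the long cycle on `n + 1` points into `n` transpositions. Conjugating the first
transposition by the long cycle, so that its two elements are rotated by one, and moving it to the
end gives another such factorization, and on the lists of smaller elements this is whirling at the
index of that transposition. Hence a full round of whirling, in any order, rotates all the
transpositions by one, and `n + 1` rounds are needed to get back to the start. Along the way, the
smaller element of a given transposition is the least point exactly twice: once for each of the two
elements rotated to that point.
-/

namespace Whirling

open Equiv Finset

section SwapProducts

variable {ι α : Type*} [DecidableEq α] {a b : ι → α} {s : List ι}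

/-- The product of the transpositions `(a i b i)`, for `i` running through the list `s`. As always
for permutations, the last factor acts first. -/
def swapProd (a b : ι → α) (s : List ι) : Perm α := (s.map fun i => swap (a i) (b i)).prod

@[simp]
theorem swapProd_nil : swapProd a b [] = 1 := rfl

@[simp]
theorem swapProd_cons (i : ι) : swapProd a b (i :: s) = swap (a i) (b i) * swapProd a b s := by
  simp [swapProd]

@[simp]
theorem swapProd_append (t : List ι) :
    swapProd a b (s ++ t) = swapProd a b s * swapProd a b t := by
  simp [swapProd]

theorem swapProd_congr {a' b' : ι → α} (h : ∀ i ∈ s, swap (a i) (b i) = swap (a' i) (b' i)) :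
    swapProd a b s = swapProd a' b' s := by
  rw [swapProd, List.map_congr_left h, swapProd]

theorem swapProd_apply_mem_iff {U : Finset α} (h : ∀ i ∈ s, a i ∈ U ↔ b i ∈ U) (x : α) :
    swapProd a b s x ∈ U ↔ x ∈ U := by
  induction s with
  | nil => simp
  | cons i s ih =>
    rw [List.forall_mem_cons] at h
    rw [swapProd_cons, Perm.mul_apply, ← ih h.2, swap_apply_def]
    split_ifs with hxa hxb
    · rw [hxa, h.1]
    · rw [hxb, h.1]
    · rfl

theorem exists_crossing_of_not_mem_iff {σ : Perm α} (hσ : swapProd a b s = σ⁻¹) {U : Finset α}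
    {x : α} (hx : ¬(σ x ∈ U ↔ x ∈ U)) : ∃ i ∈ s, ¬(a i ∈ U ↔ b i ∈ U) := by
  by_contra! h
  have hmem := swapProd_apply_mem_iff h (σ x)
  rw [hσ, Perm.inv_def, symm_apply_apply] at hmem
  exact hx hmem.symm

theorem card_le_card_touching (I : Finset ι) (S : Finset α)
    (h : ∀ U ⊆ S, U.Nonempty → ∃ i ∈ I, ¬(a i ∈ U ↔ b i ∈ U)) :
    #S ≤ #{i ∈ I | a i ∈ S ∨ b i ∈ S} := by
  induction S using Finset.strongInduction with
  | H S ih =>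
    obtain rfl | hS := S.eq_empty_or_nonempty
    · simp
    obtain ⟨i, hi, hiS⟩ := h S subset_rfl hS
    -- The edge `i` touches `S` only at its endpoint `v`, so it is lost when `v` is erased.
    obtain ⟨v, hv, hiv⟩ : ∃ v ∈ S, ¬(a i ∈ S.erase v ∨ b i ∈ S.erase v) := by
      by_cases ha : a i ∈ S
      · exact ⟨a i, ha, by simp only [mem_erase]; tauto⟩
      · exact ⟨b i, by tauto, by simp only [mem_erase]; tauto⟩
    have herase := ih (S.erase v) (erase_ssubset hv) fun U hU =>
      h U (hU.trans (erase_subset _ _))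
    have hlt : #{j ∈ I | a j ∈ S.erase v ∨ b j ∈ S.erase v} < #{j ∈ I | a j ∈ S ∨ b j ∈ S} := by
      refine card_lt_card (Finset.ssubset_iff_exists_cons_subset.2 ⟨i, by simp_all, ?_⟩)
      intro j hj
      simp only [mem_cons, mem_filter, mem_erase] at hj ⊢
      rcases hj with rfl | hj
      · exact ⟨hi, by tauto⟩
      · tauto
    have := card_erase_add_one hv
    omega

theorem prod_map_swap_eq_inv_formPerm {x : α} {l : List α} (h : (x :: l).Nodup) :
    (l.map (swap x)).prod = (x :: l).formPerm⁻¹ := by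
  induction l using List.reverseRecOn with
  | nil => simp
  | append_singleton l y ih =>
    have hrot : (x :: (l ++ [y])).formPerm = swap x y * (x :: l).formPerm := by
      have hperm : (y :: x :: l).Nodup := (List.perm_append_singleton y (x :: l)).nodup_iff.1 h
      rw [swap_comm, ← List.formPerm_cons_cons, ← List.formPerm_rotate_one _ hperm]
      simp
    rw [List.map_append, List.prod_append, ih (h.sublist (by simp)), hrot]
    simp

end SwapProducts

section LinearOrder

variable {α : Type*} [LinearOrder α]

theorem card_le_card_touching_of_lt_apply {ι : Type*} [DecidableEq ι] {a b : ι → α} {s : List ι}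
    {σ : Perm α} (hσ : swapProd a b s = σ⁻¹) {S : Finset α} (hS : ∀ x ∈ S, x < σ x) :
    #S ≤ #{i ∈ s.toFinset | a i ∈ S ∨ b i ∈ S} := by
  refine card_le_card_touching _ _ fun U hUS hU => ?_
  have hmax := U.max'_mem hU
  have hσmax : σ (U.max' hU) ∉ U := fun h => (U.le_max' _ h).not_gt (hS _ (hUS hmax))
  simpa using exists_crossing_of_not_mem_iff hσ (x := U.max' hU) (by tauto)

theorem swap_min_max (x y : α) : swap (min x y) (max x y) = swap x y := by
  rcases le_total x y with h | h
  · simp [h]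
  · simp [h, swap_comm]

theorem lt_swap_apply {a c d x : α} (hc : a < c) (hd : a < d) (hx : a < x) : a < swap c d x := by
  rw [swap_apply_def]
  split_ifs <;> assumption

/-- The factor with the smaller minimum is conjugated by the other one: this leaves its minimum
alone, and moves its maximum to an element that is still larger. -/
theorem exists_swap_mul_swap_eq {a b c d : α} (hab : a < b) (hcd : c < d) :
    ∃ b' d', a < b' ∧ c < d' ∧ swap c d' * swap a b' = swap a b * swap c d := by
  rcases lt_trichotomy a c with hac | rfl | hca
  · refine ⟨swap c d b, d, lt_swap_apply hac (hac.trans hcd) hab, hcd, ?_⟩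
    have ha : swap c d a = a := swap_apply_of_ne_of_ne hac.ne (hac.trans hcd).ne
    rw [mul_swap_eq_swap_mul, swap_apply_self, ha]
  · exact ⟨d, b, hcd, hab, rfl⟩
  · refine ⟨b, swap a b d, hab, lt_swap_apply hca (hca.trans hab) hcd, ?_⟩
    have hc : swap a b c = c := swap_apply_of_ne_of_ne hca.ne (hca.trans hab).ne
    rw [mul_swap_eq_swap_mul (swap a b), hc]

theorem exists_swapProd_eq_of_perm {ι : Type*} {s t : List ι} (hst : s.Perm t)
    (hs : s.Nodup) {lo hi : ι → α} (hlt : ∀ i, lo i < hi i) :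
    ∃ hi' : ι → α, (∀ i, lo i < hi' i) ∧ (∀ i ∉ s, hi' i = hi i) ∧
      swapProd lo hi' t = swapProd lo hi s := by
  classical
  induction hst generalizing hi with
  | nil => exact ⟨hi, hlt, fun _ _ => rfl, rfl⟩
  | cons x _ ih =>
    rw [List.nodup_cons] at hs
    obtain ⟨hi', hlt', hoff, hprod⟩ := ih hs.2 hlt
    exact ⟨hi', hlt', fun i hi => hoff i (by simp_all), by simp [hprod, hoff x hs.1]⟩
  | swap x y l =>
    obtain ⟨b, d, hb, hd, hbd⟩ := exists_swap_mul_swap_eq (hlt y) (hlt x)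
    obtain ⟨hyx, hyl, hxl, -⟩ : y ≠ x ∧ y ∉ l ∧ x ∉ l ∧ l.Nodup := by simp_all
    refine ⟨Function.update (Function.update hi y b) x d, fun i => ?_, fun i hi => by simp_all, ?_⟩
    · simp only [Function.update_apply]
      split_ifs with hix hiy
      exacts [hix ▸ hd, hiy ▸ hb, hlt i]
    · have hl : swapProd lo (Function.update (Function.update hi y b) x d) l = swapProd lo hi l :=
        swapProd_congr fun i hi => by
          rw [Function.update_of_ne (ne_of_mem_of_not_mem hi hxl),
            Function.update_of_ne (ne_of_mem_of_not_mem hi hyl)]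
      simp only [swapProd_cons, hl, Function.update_self, Function.update_of_ne hyx, ← mul_assoc,
        hbd]
  | trans hst _ ih₁ ih₂ =>
    obtain ⟨hi', hlt', hoff', hprod'⟩ := ih₁ hs hlt
    obtain ⟨hi'', hlt'', hoff'', hprod''⟩ := ih₂ (hst.nodup_iff.1 hs) hlt'
    refine ⟨hi'', hlt'', fun i hi => ?_, hprod''.trans hprod'⟩
    rw [hoff'' i (mt hst.mem_iff.2 hi), hoff' i hi]

end LinearOrder

variable {n : ℕ}

section FinCycles

theorem formPerm_finRange (n : ℕ) : (List.finRange (n + 1)).formPerm = finRotate (n + 1) := by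
  ext x
  have h := List.formPerm_apply_getElem _ (List.nodup_finRange (n + 1)) x (by simp [x.is_le])
  simp only [List.getElem_finRange, List.length_finRange, Fin.cast_mk, Fin.eta] at h
  simp [h, Fin.val_add]

theorem swapProd_zero_succ_finRange :
    swapProd (fun _ : Fin n => (0 : Fin (n + 1))) Fin.succ (List.finRange n) =
      (finRotate (n + 1))⁻¹ := by
  have hnodup := List.nodup_finRange (n + 1)
  rw [← formPerm_finRange, List.finRange_succ] at *
  rw [← prod_map_swap_eq_inv_formPerm hnodup, swapProd, List.map_map]
  rfl

variable {k : Fin n} {σ : Perm (Fin (n + 1))} {ι : Type*} {a b : ι → Fin (n + 1)} {s : List ι}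

theorem mem_iff_lt_of_apply_mem_iff (hσ : ∀ x : Fin n, x ≠ k → σ x.castSucc = x.succ)
    {U : Finset (Fin (n + 1))} (hU : ∀ x, σ x ∈ U ↔ x ∈ U) (h0 : 0 ∉ U) (hne : U.Nonempty)
    (x : Fin (n + 1)) : x ∈ U ↔ k.castSucc < x := by
  have hlow (x) (hx : x ≤ k.castSucc) : x ∉ U := by
    induction x using Fin.induction with
    | zero => exact h0
    | succ x ih =>
      rw [Fin.succ_le_castSucc_iff] at hx
      rw [← hσ x hx.ne, hU]
      exact ih (Fin.castSucc_le_castSucc_iff.2 hx.le)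
  have hhigh (x) (hx : k.castSucc < x) : x ∈ U ↔ Fin.last n ∈ U := by
    induction x using Fin.reverseInduction with
    | last => rfl
    | cast x ih =>
      have hkx : k < x := by simpa using hx
      rw [← ih (hx.trans Fin.castSucc_lt_succ), ← hσ x hkx.ne', hU]
  obtain ⟨y, hy⟩ := hne
  have hlast : Fin.last n ∈ U := (hhigh y (not_le.1 fun h => hlow y h hy)).1 hy
  exact ⟨fun hx => not_le.1 fun h => hlow x h hx, fun hx => (hhigh x hx).2 hlast⟩

/-- If some factor crossed, the factors would be the edges of a connected graph on `n + 1` vertices,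
so that there would be at least `n` of them. -/
theorem not_crossing_of_length_lt (hσ : ∀ x : Fin n, x ≠ k → σ x.castSucc = x.succ)
    (hprod : swapProd a b s = σ⁻¹) (hlen : s.length < n) {i : ι} (hi : i ∈ s) :
    k.castSucc < a i ↔ k.castSucc < b i := by
  classical
  by_contra hcross
  have hcard : #(univ.erase (0 : Fin (n + 1))) ≤ _ :=
    card_le_card_touching (a := a) (b := b) s.toFinset _ fun U hU hne => by
      by_cases hinv : ∀ x, σ x ∈ U ↔ x ∈ U
      · have h0 : 0 ∉ U := fun h => by simpa using hU h
        have hmem := mem_iff_lt_of_apply_mem_iff hσ hinv h0 hne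
        exact ⟨i, by simpa using hi, by rwa [hmem, hmem]⟩
      · push Not at hinv
        obtain ⟨x, hx⟩ := hinv
        simpa using exists_crossing_of_not_mem_iff hprod (x := x) (by tauto)
  have hle := (hcard.trans (card_filter_le _ _)).trans s.toFinset_card_le
  rw [card_erase_of_mem (mem_univ _), card_univ, Fintype.card_fin] at hle
  omega

theorem le_card_filter_lt_min [DecidableEq ι]
    (hσ : ∀ x : Fin n, x ≠ k → σ x.castSucc = x.succ)
    (hprod : swapProd a b s = σ⁻¹) (hlen : s.length < n) :
    n - k - 1 ≤ #{i ∈ s.toFinset | k.castSucc < min (a i) (b i)} := by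
  have hup : ∀ x ∈ Ioo k.castSucc (Fin.last n), x < σ x := fun x hx => by
    obtain ⟨hkx, hx⟩ := mem_Ioo.1 hx
    obtain ⟨y, rfl⟩ := Fin.exists_castSucc_eq.2 hx.ne
    rw [hσ y (by simpa using hkx.ne')]
    exact Fin.castSucc_lt_succ
  calc n - k - 1 = #(Ioo k.castSucc (Fin.last n)) := by simp
    _ ≤ _ := card_le_card_touching_of_lt_apply hprod hup
    _ ≤ _ := card_le_card fun i hi => by
      simp only [mem_filter, List.mem_toFinset, mem_Ioo, lt_min_iff] at hi ⊢
      have := not_crossing_of_length_lt hσ hprod hlen hi.1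
      tauto

theorem min_add_one_add_one_of_max_eq_last {x y : Fin (n + 1)} (h : max x y = Fin.last n) :
    min (x + 1) (y + 1) = 0 := by
  rcases max_choice x y with hxy | hxy <;> rw [h] at hxy <;> simp [← hxy]

theorem val_min_add_one_add_one_of_max_ne_last {x y : Fin (n + 1)} (h : max x y ≠ Fin.last n) :
    ((min (x + 1) (y + 1) : Fin (n + 1)) : ℕ) = (min x y : Fin (n + 1)) + 1 := by
  have hmax : max x y < Fin.last n := Fin.lt_last_iff_ne_last.2 h
  obtain ⟨hx, hy⟩ := max_lt_iff.1 hmax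
  rw [Fin.coe_min, Fin.coe_min, Fin.val_add_one_of_lt hx, Fin.val_add_one_of_lt hy,
    min_add_add_right]

theorem val_nsmul_one (x : Fin (n + 1)) : (x : ℕ) • (1 : Fin (n + 1)) = x := by
  induction x using Fin.induction with
  | zero => simp
  | succ x ih => rw [Fin.val_succ, succ_nsmul, ← Fin.val_castSucc, ih, Fin.coeSucc_eq_succ]

theorem exists_not_add_one_mem_iff (hn : 2 ≤ n) {d : Fin (n + 1)} (hd : d ≠ 0) :
    ∃ x : Fin (n + 1), ¬(x + 1 ∈ ({0, d} : Finset (Fin (n + 1))) ↔ x ∈ ({0, d} : Finset _)) := by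
  by_contra! hU
  have : NeZero n := ⟨by omega⟩
  have h1 : (1 : Fin (n + 1)) ≠ 0 := by simp
  have h2 : (1 + 1 : Fin (n + 1)) ≠ 0 := by
    simp [Fin.ext_iff, Fin.val_add, Nat.mod_eq_of_lt (by omega : 2 < n + 1)]
  obtain rfl : 1 = d := by simpa [h1] using hU 0
  simpa [h1, h2] using hU 1

end FinCycles

section Parking

theorem isParking_iff_lt_card {f : Fin n → Fin n} :
    IsParking f ↔ ∀ j : Fin n, (j : ℕ) < #{i | f i ≤ j} := by
  refine forall_congr' fun j => ?_
  have hcard : #{i | (f ∘ Tuple.sort f) i ≤ j} = #{i | f i ≤ j} :=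
    card_equiv (Tuple.sort f) (by simp)
  rw [← hcard, Tuple.lt_card_le_iff_apply_le_of_monotone (Tuple.monotone_sort f)]

theorem IsParking.mono {f g : Fin n → Fin n} (hf : IsParking f) (hgf : g ≤ f) : IsParking g := by
  rw [isParking_iff_lt_card] at hf ⊢
  exact fun j => (hf j).trans_le <|
    card_le_card <| monotone_filter_right _ fun i _ hi => (hgf i).trans hi

end Parking

section Whirl

variable {k : ℕ} {F : Set (Fin n → Fin k)} {i : Fin n} {f : F} {v : Fin k}

theorem val_finRotate_iterate (m : ℕ) (x : Fin k) : ((finRotate k)^[m] x : ℕ) = (x + m) % k := by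
  have := x.neZero
  induction m with
  | zero => simp [Nat.mod_eq_of_lt x.2]
  | succ m ih =>
    rw [Function.iterate_succ_apply', finRotate_apply, Fin.val_add, ih, Fin.val_one',
      ← Nat.add_mod, add_assoc]

theorem whirlAt_eq_bump {m : ℕ} (hm : 0 < m) (hF : bump f.1 i m ∈ F)
    (hmin : ∀ m', 0 < m' → m' < m → bump f.1 i m' ∉ F) : (whirlAt F i f).1 = bump f.1 i m := by
  classical
  have hfind : Nat.find (exists_bump_mem i f) = m :=
    (Nat.find_eq_iff _).2 ⟨⟨hm, hF⟩, fun m' hm' h => hmin m' h.1 hm' h.2⟩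
  rw [← hfind]
  simp only [whirlAt, ofBijective_apply, whirlFun]

theorem whirlAt_eq_update_succ (hv : (v : ℕ) = f.1 i + 1) (hF : Function.update f.1 i v ∈ F) :
    (whirlAt F i f).1 = Function.update f.1 i v := by
  have hbump : bump f.1 i 1 = Function.update f.1 i v := by
    rw [bump, Fin.ext (a := (finRotate k)^[1] (f.1 i)) (b := v)]
    rw [val_finRotate_iterate, ← hv, Nat.mod_eq_of_lt v.2]
  rw [← hbump] at hF ⊢
  exact whirlAt_eq_bump one_pos hF (by omega)

theorem whirlAt_eq_update_zero (hv : (v : ℕ) = 0) (hF : Function.update f.1 i v ∈ F)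
    (hmax : ∀ u : Fin k, f.1 i < u → Function.update f.1 i u ∉ F) :
    (whirlAt F i f).1 = Function.update f.1 i v := by
  have hlt := (f.1 i).2
  have hbump : bump f.1 i (k - f.1 i) = Function.update f.1 i v := by
    rw [bump, Fin.ext (a := (finRotate k)^[k - f.1 i] (f.1 i)) (b := v)]
    rw [val_finRotate_iterate, Nat.add_sub_cancel' hlt.le, Nat.mod_self, hv]
  rw [← hbump] at hF ⊢
  refine whirlAt_eq_bump (by omega) hF fun m hm hmk => hmax _ ?_
  rw [Fin.lt_def, val_finRotate_iterate, Nat.mod_eq_of_lt (by omega)]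
  omega

/-- Whirling successively at the indices of the list `s`, from its head to its last element. It
covers `whirl` and `whirlPerm`, and allows for induction on the list of indices. -/
noncomputable def whirlList (F : Set (Fin n → Fin k)) (s : List (Fin n)) : Perm F :=
  (s.map fun i => whirlAt F i).reverse.prod

@[simp]
theorem whirlList_nil : whirlList F [] = 1 := rfl

@[simp]
theorem whirlList_cons (i : Fin n) (s : List (Fin n)) :
    whirlList F (i :: s) = whirlList F s * whirlAt F i := by
  simp [whirlList]

theorem whirlPerm_eq_whirlList (π : Perm (Fin n)) :
    whirlPerm F π = whirlList F ((List.finRange n).map π) := by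
  rw [whirlPerm, whirlList, List.map_map]
  rfl

end Whirl

/-- The transpositions `(a i b i)`, multiplied in the order `s` of the indices, form a factorization
of the inverse of the long cycle on `Fin (n + 1)`, and `f` lists their smaller elements. Such
factorizations stand for the parking function `f`; the two elements `a i` and `b i` are not ordered,
so that rotating a transposition amounts to adding `1` to both of them. -/
structure Encodes (s : List (Fin n)) (a b : Fin n → Fin (n + 1)) (f : Fin n → Fin n) : Prop where
  perm : s.Perm (List.finRange n)
  ne : ∀ i, a i ≠ b i
  min_eq : ∀ i, min (a i) (b i) = (f i).castSucc
  prod_eq : swapProd a b s = (finRotate (n + 1))⁻¹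

namespace Encodes

variable {s t : List (Fin n)} {i : Fin n} {a b : Fin n → Fin (n + 1)} {f : Fin n → Fin n}

theorem toFinset_eq_univ (h : Encodes s a b f) : s.toFinset = univ := by
  ext i
  simp [h.perm.mem_iff]

theorem toFinset_tail_eq_erase (h : Encodes (i :: s) a b f) : s.toFinset = univ.erase i := by
  have hi : i ∉ s := (List.nodup_cons.1 (h.perm.nodup_iff.2 (List.nodup_finRange n))).1
  rw [← h.toFinset_eq_univ, List.toFinset_cons, erase_insert (by simpa using hi)]

theorem apply_eq_zero_iff (h : Encodes s a b f) (i : Fin n) :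
    (f i : ℕ) = 0 ↔ a i = 0 ∨ b i = 0 := by
  rw [← Fin.val_castSucc, ← h.min_eq, Fin.val_eq_zero_iff]
  simp only [← Fin.le_zero_iff, min_le_iff]

theorem exists_ne_add (h : Encodes s a b f) (hn : 2 ≤ n) {d : Fin (n + 1)} (hd : d ≠ 0) :
    ∃ i, ¬(a i = b i + d ∧ b i = a i + d) := by
  obtain ⟨x, hx⟩ := exists_not_add_one_mem_iff hn hd
  obtain ⟨i, -, hi⟩ := exists_crossing_of_not_mem_iff h.prod_eq (x := x) (by rwa [finRotate_apply])
  refine ⟨i, fun hadd => hi ?_⟩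
  obtain ⟨ha, hb⟩ := hadd
  grind

theorem isParking (h : Encodes s a b f) : IsParking f := by
  refine isParking_iff_lt_card.2 fun j => ?_
  have hup : ∀ x ∈ Iic j.castSucc, x < finRotate (n + 1) x := fun x hx =>
    (lt_finRotate_iff_ne_last x).2 ((mem_Iic.1 hx).trans_lt (Fin.castSucc_lt_last j)).ne
  calc (j : ℕ) < #(Iic j.castSucc) := by simp
    _ ≤ _ := card_le_card_touching_of_lt_apply h.prod_eq hup
    _ ≤ _ := card_le_card fun i hi => by
      simp only [mem_filter, mem_Iic, ← min_le_iff, h.min_eq] at hi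
      simpa using hi.2

theorem card_filter_le_of_max_eq_last (h : Encodes (i :: s) a b f)
    (hmax : max (a i) (b i) = Fin.last n) : #{j ∈ univ.erase i | f j ≤ f i} ≤ f i := by
  set c := finRotate (n + 1)
  have hprod : swapProd a b s = (c * swap (f i).castSucc (Fin.last n))⁻¹ := by
    rw [mul_inv_rev, ← h.prod_eq, swapProd_cons, swap_inv, ← h.min_eq, ← hmax, swap_min_max,
      swap_mul_self_mul]
  have hσ : ∀ x : Fin n, x ≠ f i →
      (c * swap (f i).castSucc (Fin.last n)) x.castSucc = x.succ := fun x hx => by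
    rw [Perm.mul_apply, swap_apply_of_ne_of_ne (by simpa using hx) x.castSucc_ne_last,
      finRotate_apply, Fin.coeSucc_eq_succ]
  have hlen : s.length + 1 = n := by simpa using h.perm.length_eq
  have hcard := le_card_filter_lt_min hσ hprod (by omega)
  have hsplit := card_filter_add_card_filter_not (s := univ.erase i) fun j => f j ≤ f i
  simp only [h.toFinset_tail_eq_erase, h.min_eq, Fin.castSucc_lt_castSucc_iff] at hcard
  simp only [not_le, card_erase_of_mem (mem_univ i), card_univ, Fintype.card_fin] at hsplit
  omega

theorem not_isParking_update_of_lt (h : Encodes (i :: s) a b f)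
    (hmax : max (a i) (b i) = Fin.last n) {u : Fin n} (hu : f i < u) :
    ¬IsParking (Function.update f i u) := fun hpark => by
  have hlt := isParking_iff_lt_card.1 hpark (f i)
  have hfilter : ({j | Function.update f i u j ≤ f i} : Finset (Fin n)) =
      {j ∈ univ.erase i | f j ≤ f i} := by
    ext j
    obtain rfl | hj := eq_or_ne j i
    · simpa using hu
    · simp [hj]
  rw [hfilter] at hlt
  exact hlt.not_ge (h.card_filter_le_of_max_eq_last hmax)

theorem rotate (h : Encodes (i :: s) a b f) {v : Fin n}
    (hv : min (a i + 1) (b i + 1) = v.castSucc) :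
    Encodes (s ++ [i]) (a + Pi.single i 1) (b + Pi.single i 1) (Function.update f i v) where
  perm := (List.perm_append_singleton _ _).trans h.perm
  ne j := by simpa using h.ne j
  min_eq j := by
    obtain rfl | hj := eq_or_ne j i
    · simpa using hv
    · simpa [hj] using h.min_eq j
  prod_eq := by
    have hi : i ∉ s := (List.nodup_cons.1 (h.perm.nodup_iff.2 (List.nodup_finRange n))).1
    have hs : swapProd (a + Pi.single i 1) (b + Pi.single i 1) s = swapProd a b s :=
      swapProd_congr fun j hj => by simp [ne_of_mem_of_not_mem hj hi]
    have hprod : swapProd a b s = swap (a i) (b i) * (finRotate (n + 1))⁻¹ := by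
      rw [← h.prod_eq, swapProd_cons, swap_mul_self_mul]
    have hrot : swap (a i + 1) (b i + 1) =
        finRotate (n + 1) * swap (a i) (b i) * (finRotate (n + 1))⁻¹ := by
      rw [← swap_apply_apply, finRotate_apply, finRotate_apply]
    rw [swapProd_append, hs, hprod]
    simp [hrot, mul_assoc]

theorem whirlAt_head {f : Park n} (h : Encodes (i :: s) a b f.1) :
    Encodes (s ++ [i]) (a + Pi.single i 1) (b + Pi.single i 1) (whirlAt (Park n) i f).1 := by
  by_cases hmax : max (a i) (b i) = Fin.last n
  · have hrot := h.rotate (v := ⟨0, i.pos⟩) (min_add_one_add_one_of_max_eq_last hmax)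
    rwa [whirlAt_eq_update_zero (v := ⟨0, i.pos⟩) rfl hrot.isParking fun u =>
      h.not_isParking_update_of_lt hmax]
  · have hval := val_min_add_one_add_one_of_max_ne_last hmax
    rw [h.min_eq, Fin.val_castSucc] at hval
    have hlt : (f.1 i : ℕ) + 1 < n := by
      have hlt_max : min (a i) (b i) < max (a i) (b i) := min_lt_max.2 (h.ne i)
      have := Fin.lt_last_iff_ne_last.2 hmax
      simp only [h.min_eq, Fin.lt_def, Fin.val_castSucc, Fin.val_last] at hlt_max this
      omega
    have hrot := h.rotate (v := ⟨f.1 i + 1, hlt⟩) (Fin.ext hval)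
    rwa [whirlAt_eq_update_succ (v := ⟨f.1 i + 1, hlt⟩) rfl hrot.isParking]

theorem exists_of_perm (h : Encodes s a b f) (hst : s.Perm t) : ∃ a' b', Encodes t a' b' f := by
  obtain ⟨hi, hlt, -, hprod⟩ := exists_swapProd_eq_of_perm hst
    (h.perm.nodup_iff.2 (List.nodup_finRange n)) fun i => min_lt_max.2 (h.ne i)
  refine ⟨_, hi, hst.symm.trans h.perm, fun i => (hlt i).ne, fun i => ?_, hprod.trans ?_⟩
  · rw [min_eq_left (hlt i).le, h.min_eq]
  · rw [← h.prod_eq]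
    exact swapProd_congr fun i _ => swap_min_max _ _

/-- Lowering a nonzero value `f i` by one gives a parking function from which whirling at `i` leads
back to `f`, so that a factorization for it can be rotated into one for `f`. -/
theorem exists_of_isParking (hs : s.Perm (List.finRange n)) (hf : IsParking f) :
    ∃ a b, Encodes s a b f := by
  induction hN : ∑ i, (f i : ℕ) using Nat.strong_induction_on generalizing f s with
  | _ N ih =>
    by_cases h0 : ∀ i, (f i : ℕ) = 0
    · have hstar : Encodes (List.finRange n) (fun _ => 0) Fin.succ f :=
        ⟨List.Perm.refl _, fun i => (Fin.succ_ne_zero i).symm,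
          fun i => by simp [Fin.ext_iff, h0 i], swapProd_zero_succ_finRange⟩
      exact hstar.exists_of_perm hs.symm
    · push Not at h0
      obtain ⟨i, hi⟩ := h0
      set v : Fin n := ⟨f i - 1, by omega⟩ with hv
      have hle : Function.update f i v ≤ f :=
        update_le_self_iff.2 (Fin.le_def.2 (Nat.sub_le _ _))
      have hlt : ∑ j, (Function.update f i v j : ℕ) < N := hN ▸ sum_lt_sum (fun j _ => hle j)
        ⟨i, mem_univ i, by rw [Function.update_self, hv]; exact Nat.sub_one_lt hi⟩
      have hsi : s.Perm (i :: s.erase i) :=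
        List.perm_cons_erase (hs.mem_iff.2 (List.mem_finRange i))
      have hg := hf.mono hle
      obtain ⟨a, b, h⟩ := ih _ hlt (hsi.symm.trans hs) hg rfl
      have hwhirl : (whirlAt (Park n) i ⟨_, hg⟩).1 = f := by
        have hf' : Function.update (Function.update f i v) i (f i) = f := by simp
        rw [whirlAt_eq_update_succ (v := f i) _ (hf'.symm ▸ hf), hf']
        simp only [Function.update_self, hv]
        omega
      have hrot := whirlAt_head (f := ⟨_, hg⟩) h
      rw [hwhirl] at hrot
      exact hrot.exists_of_perm ((List.perm_append_singleton _ _).trans hsi.symm)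

theorem whirlList_append {f : Park n} (h : Encodes (s ++ t) a b f.1) :
    Encodes (t ++ s) (a + (s.map fun i => Pi.single i 1).sum)
      (b + (s.map fun i => Pi.single i 1).sum) (whirlList (Park n) s f).1 := by
  induction s generalizing t a b f with
  | nil => simpa using h
  | cons i s ih =>
    rw [List.cons_append] at h
    have hrot := h.whirlAt_head
    rw [List.append_assoc] at hrot
    simpa [add_assoc] using ih hrot

variable {f : Park n}

theorem whirlList_apply (h : Encodes s a b f.1) :
    Encodes s (a + 1) (b + 1) (whirlList (Park n) s f).1 := by
  have hsum : (s.map fun i => (Pi.single i 1 : Fin n → Fin (n + 1))).sum = 1 := by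
    rw [(h.perm.map _).sum_eq, ← List.ofFn_eq_map, List.sum_ofFn]
    exact univ_sum_single 1
  have hround := whirlList_append (t := []) (s.append_nil.symm ▸ h)
  rwa [hsum] at hround

theorem whirlList_pow_apply (h : Encodes s a b f.1) (m : ℕ) :
    Encodes s (a + m • 1) (b + m • 1) ((whirlList (Park n) s ^ m) f).1 := by
  induction m with
  | zero => simpa using h
  | succ m ih => simpa [succ_nsmul, add_assoc, pow_succ'] using ih.whirlList_apply

theorem whirlList_pow_apply_eq_zero_iff (h : Encodes s a b f.1) (m : ℕ) (i : Fin n) :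
    (((whirlList (Park n) s ^ m) f).1 i : ℕ) = 0 ↔
      m • (1 : Fin (n + 1)) = -a i ∨ m • (1 : Fin (n + 1)) = -b i := by
  rw [(h.whirlList_pow_apply m).apply_eq_zero_iff]
  simp only [Pi.add_apply, Pi.smul_apply, Pi.one_apply, eq_neg_iff_add_eq_zero, add_comm]

theorem whirlList_pow_apply_eq_iff (h : Encodes s a b f.1) (hn : 2 ≤ n) (j k : ℕ) :
    (whirlList (Park n) s ^ j) f = (whirlList (Park n) s ^ k) f ↔
      j • (1 : Fin (n + 1)) = k • 1 := by
  refine ⟨fun hjk => ?_, fun hjk => ?_⟩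
  · by_contra hne
    obtain ⟨i, hi⟩ := h.exists_ne_add hn (sub_ne_zero.2 hne)
    -- The value at `i` becomes `0` at the same later rounds on both sides, so that `a i` and `b i`
    -- differ by `j • 1 - k • 1` in both directions.
    have hzero (x : Fin (n + 1)) : (x + j • 1 = -a i ∨ x + j • 1 = -b i) ↔
        (x + k • 1 = -a i ∨ x + k • 1 = -b i) := by
      rw [← val_nsmul_one x, ← add_nsmul, ← add_nsmul, ← h.whirlList_pow_apply_eq_zero_iff,
        ← h.whirlList_pow_apply_eq_zero_iff, pow_add, pow_add, Perm.mul_apply, Perm.mul_apply, hjk]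
    have ha := hzero (-a i - j • 1)
    have hb := hzero (-b i - j • 1)
    grind
  · ext i : 2
    have hj := (h.whirlList_pow_apply j).min_eq i
    have hk := (h.whirlList_pow_apply k).min_eq i
    simp only [Pi.add_apply, Pi.smul_apply, Pi.one_apply, hjk] at hj hk
    exact Fin.castSucc_injective n (hj.symm.trans hk)

end Encodes

theorem mem_orbit_zpowers_iff {X : Type*} [Finite X] {σ : Perm X} {x y : X} :
    y ∈ MulAction.orbit (Subgroup.zpowers σ) x ↔ ∃ m : ℕ, (σ ^ m) x = y := by
  constructor
  · rintro ⟨⟨g, hg⟩, rfl⟩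
    obtain ⟨m, rfl⟩ := mem_powers_iff_mem_zpowers.2 hg
    exact ⟨m, rfl⟩
  · rintro ⟨m, rfl⟩
    exact ⟨⟨σ ^ m, pow_mem (Subgroup.mem_zpowers σ) m⟩, rfl⟩

namespace Encodes

variable {s : List (Fin n)} {a b : Fin n → Fin (n + 1)} {f : Park n}

theorem injective_whirlList_pow_apply (h : Encodes s a b f.1) (hn : 2 ≤ n) :
    Function.Injective fun x : Fin (n + 1) => (whirlList (Park n) s ^ (x : ℕ)) f :=
  fun x y hxy => by simpa only [h.whirlList_pow_apply_eq_iff hn, val_nsmul_one] using hxy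

theorem orbit_eq_range (h : Encodes s a b f.1) (hn : 2 ≤ n) :
    MulAction.orbit (Subgroup.zpowers (whirlList (Park n) s)) f =
      Set.range fun x : Fin (n + 1) => (whirlList (Park n) s ^ (x : ℕ)) f := by
  ext g
  rw [mem_orbit_zpowers_iff, Set.mem_range]
  constructor
  · rintro ⟨m, rfl⟩
    exact ⟨m • 1, by rw [h.whirlList_pow_apply_eq_iff hn, val_nsmul_one]⟩
  · rintro ⟨x, rfl⟩
    exact ⟨x, rfl⟩

theorem setOf_mem_orbit_apply_eq_zero (h : Encodes s a b f.1) (hn : 2 ≤ n) (i : Fin n) :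
    {g ∈ MulAction.orbit (Subgroup.zpowers (whirlList (Park n) s)) f | (g.1 i : ℕ) = 0} =
      (fun x : Fin (n + 1) => (whirlList (Park n) s ^ (x : ℕ)) f) '' {-a i, -b i} := by
  rw [h.orbit_eq_range hn]
  ext g
  constructor
  · rintro ⟨⟨x, rfl⟩, hx⟩
    refine ⟨x, ?_, rfl⟩
    rwa [h.whirlList_pow_apply_eq_zero_iff, val_nsmul_one] at hx
  · rintro ⟨x, hx, rfl⟩
    refine ⟨⟨x, rfl⟩, ?_⟩
    rwa [h.whirlList_pow_apply_eq_zero_iff, val_nsmul_one]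

end Encodes

theorem ncard_of_mem_orbits_whirlList (hn : 2 ≤ n) {s : List (Fin n)}
    (hs : s.Perm (List.finRange n)) {O : Set (Park n)} (hO : O ∈ orbits (whirlList (Park n) s)) :
    O.ncard = n + 1 ∧ ∀ i, {f ∈ O | (f.1 i : ℕ) = 0}.ncard = 2 := by
  obtain ⟨f, rfl⟩ := hO
  beta_reduce
  obtain ⟨a, b, h⟩ := Encodes.exists_of_isParking hs f.2
  have hinj := h.injective_whirlList_pow_apply hn
  refine ⟨?_, fun i => ?_⟩
  · rw [h.orbit_eq_range hn, Set.ncard_range_of_injective hinj, Nat.card_fin]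
  · rw [h.setOf_mem_orbit_apply_eq_zero hn i, Set.ncard_image_of_injective _ hinj,
      Set.ncard_pair (neg_injective.ne (h.ne i))]

end Whirling

/-- Every orbit of whirling on `Park n` has size `n + 1` and, for each index `i`, contains exactly
two parking functions whose value at `i` is the least element of `[n]` (the integer `1`, which is
`0` in `Fin n`); the same holds for whirling in any order `π`. -/
theorem mainTheorem2 (n : ℕ) (hn : 2 ≤ n) :
    (∀ O ∈ Whirling.orbits (Whirling.whirl (Whirling.Park n)),
      O.ncard = n + 1 ∧
      ∀ i : Fin n, {f ∈ O | ((f : Fin n → Fin n) i : ℕ) = 0}.ncard = 2) ∧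
    (∀ π : Equiv.Perm (Fin n),
      ∀ O ∈ Whirling.orbits (Whirling.whirlPerm (Whirling.Park n) π),
        O.ncard = n + 1 ∧
        ∀ i : Fin n, {f ∈ O | ((f : Fin n → Fin n) i : ℕ) = 0}.ncard = 2) := by
  refine ⟨fun O hO => ?_, fun π O hO => ?_⟩
  · exact Whirling.ncard_of_mem_orbits_whirlList hn (List.Perm.refl _) hO
  · rw [Whirling.whirlPerm_eq_whirlList] at hO
    exact Whirling.ncard_of_mem_orbits_whirlList hn π.map_finRange_perm hO
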